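/- Let $R$ be an associative ring with $1$; modules are right $R$-modules. For a module $M$, let $\sigma(M)$ be the class of modules isomorphic to a submodule of a quotient of a direct sum of copies of $M$. A module $E$ is almost $N$-injective if for every submodule $N'\subseteq N$ with inclusion $\iota:N'\to N$ and every homomorphism $f:N'\to E$, either there is $g:N\to E$ with $f=g\iota$, or there are a nonzero idempotent $\pi\in\operatorname{End}_R(N)$ and a homomorphism $h:E\to\pi(N)$ with $hf=\pi\iota$; it is $N$-injective if the first alternative always holds. A module $P$ is $M$-projective if every homomorphism from $P$ to a quotient $M/K$ lifts to a homomorphism $P\to M$. A module $M$ is a $V$-module if every simple module is $M$-injective, and an almost $V$-module if every simple module is almost $N$-injective for every $N\in\sigma(M)$. A module is local if it has a largest proper submodule. The Jacobson radical $J(N)$ is the intersection of all maximal submodules of $N$ (equal to $N$ if there are none), and the injective hull $E_M(S)$ of $S\in\sigma(M)$ is an essential extension $E\in\sigma(M)$ of $S$ that is $X$-injective for every $X\in\sigma(M)$. Let $M$ be an almost $V$-module. Then: 1. For every $N\in\sigma(M)$, the Jacobson radical $J(N)$ is semisimple. 2. For every $N\in\sigma(M)$, the factor module $N/J(N)$ is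 a $V$-module. 3. For every simple module $S\in\sigma(M)$, the injective hull $E_M(S)$ is either a simple module or a local $M$-projective module of length two. -/

import Mathlib

universe u v

namespace AlmostV

section Definitions

variable (R : Type u) [Ring R]

/-- `N ∈ σ(M)`: `N` is subgenerated by `M`, i.e. it embeds in a quotient of a direct sum of
copies of `M`. -/
def IsSubgenerated (M N : Type v) [AddCommGroup M] [Module R M]
    [AddCommGroup N] [Module R N] : Prop :=
  ∃ (I : Type v) (K : Submodule R (I →₀ M)) (i : N →ₗ[R] ((I →₀ M) ⧸ K)), Function.Injective i

/-- `E` is `N`-injective. -/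
def IsRelInjective (N E : Type v) [AddCommGroup N] [Module R N]
    [AddCommGroup E] [Module R E] : Prop :=
  ∀ (N' : Submodule R N) (f : N' →ₗ[R] E), ∃ g : N →ₗ[R] E, g ∘ₗ N'.subtype = f

/-- `P` is `N`-projective. -/
def IsRelProjective (N P : Type v) [AddCommGroup N] [Module R N]
    [AddCommGroup P] [Module R P] : Prop :=
  ∀ (K : Submodule R N) (f : P →ₗ[R] (N ⧸ K)), ∃ g : P →ₗ[R] N, K.mkQ ∘ₗ g = f

/-- `E` is almost `N`-injective. -/
def IsAlmostRelInjective (N E : Type v) [AddCommGroup N] [Module R N]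
    [AddCommGroup E] [Module R E] : Prop :=
  ∀ (N' : Submodule R N) (f : N' →ₗ[R] E),
    (∃ g : N →ₗ[R] E, g ∘ₗ N'.subtype = f) ∨
    ∃ p : Module.End R N, p ≠ 0 ∧ IsIdempotentElem p ∧
      ∃ h : E →ₗ[R] LinearMap.range p, ∀ x : N', (h (f x) : N) = p (x : N)

/-- `M` is a `V`-module: every simple module is `M`-injective. -/
def IsVModule (M : Type v) [AddCommGroup M] [Module R M] : Prop :=
  ∀ (S : Type v) [AddCommGroup S] [Module R S], IsSimpleModule R S → IsRelInjective R M S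

/-- `M` is an almost `V`-module: every simple module is almost `N`-injective for all
`N ∈ σ(M)`. -/
def IsAlmostVModule (M : Type v) [AddCommGroup M] [Module R M] : Prop :=
  ∀ (S : Type v) [AddCommGroup S] [Module R S], IsSimpleModule R S →
    ∀ (N : Type v) [AddCommGroup N] [Module R N], IsSubgenerated R M N →
      IsAlmostRelInjective R N S

/-- A local module: one that has a largest proper submodule. -/
def IsLocalModule (M : Type v) [AddCommGroup M] [Module R M] : Prop :=
  ∃ K : Submodule R M, K ≠ ⊤ ∧ ∀ L : Submodule R M, L ≠ ⊤ → L ≤ K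

/-- `i : S → E` is an injective hull of `S` in the category `σ(M)`: `E` is an injective object
of `σ(M)` and `i` is an essential monomorphism. -/
structure IsInjectiveHullIn (M : Type v) [AddCommGroup M] [Module R M]
    {S E : Type v} [AddCommGroup S] [Module R S] [AddCommGroup E] [Module R E]
    (i : S →ₗ[R] E) : Prop where
  mem : IsSubgenerated R M E
  injective_object : ∀ (X : Type v) [AddCommGroup X] [Module R X],
    IsSubgenerated R M X → IsRelInjective R X E
  mono : Function.Injective i
  essential : ∀ L : Submodule R E, L ⊓ LinearMap.range i = ⊥ → L = ⊥

end Definitions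

end AlmostV

/-!
Call a module with a least nonzero submodule `S` monolithic. If `Q ∈ σ(M)` is monolithic and not
simple, then every epimorphism `q : N → Q` with `N ∈ σ(M)` splits: the restriction of `q` to
`q⁻¹(S)`, viewed as a homomorphism to `S`, cannot extend to `N`, and the idempotent provided by
almost injectivity has the same kernel as `q`. Hence `Q` is `M`-projective.

For `x ∉ Z ⊆ N`, a submodule `C ⊇ Z` maximal among those avoiding `x` has a monolithic quotient
`N/C`, so `C` is maximal in `N` or `N → N/C` splits. In the second case `N` has a simple submodule
not contained in `C`. With `Z` the socle, this gives `J(N) ⊆ Z`. If `J(N) = 0`, some maximal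
submodule avoids that simple submodule, hence `N/C` embeds in a simple module and `C` is maximal in
either case. Thus every submodule of `N` is an intersection of maximal ones, which characterizes
`V`-modules.

A nonsimple hull `E` of a simple module `S` is monolithic, and an expression `E = L₁ + L₂` splits
`L₁ × L₂ → E`. One of the two components of the splitting is then an injective endomorphism, hence
surjective because `E` is injective and indecomposable, so `L₁ = E` or `L₂ = E`. Therefore `E` has
at most one maximal submodule. It is `S`, because the choice `Z = S` above shows that `S` is an
intersection of maximal submodules.
-/

namespace AlmostV

variable {A : Type u} [Ring A]

theorem exists_comp_eq_of_ker_le_ker {N Q X : Type*} [AddCommGroup N] [Module A N]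
    [AddCommGroup Q] [Module A Q] [AddCommGroup X] [Module A X] {q : N →ₗ[A] Q}
    (hq : Function.Surjective q) {g : N →ₗ[A] X} (h : LinearMap.ker q ≤ LinearMap.ker g) :
    ∃ g' : Q →ₗ[A] X, g' ∘ₗ q = g := by
  refine ⟨(LinearMap.ker q).liftQ g h ∘ₗ (q.quotKerEquivOfSurjective hq).symm.toLinearMap,
    LinearMap.ext fun z => ?_⟩
  have hz : (q.quotKerEquivOfSurjective hq).symm (q z) = Submodule.Quotient.mk z :=
    (LinearEquiv.symm_apply_eq _).2 rfl
  simp only [LinearMap.comp_apply, LinearEquiv.coe_coe, hz, Submodule.liftQ_apply]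

section Subgenerated

variable {M N X : Type v} [AddCommGroup M] [Module A M] [AddCommGroup N] [Module A N]
  [AddCommGroup X] [Module A X]

theorem isSubgenerated_of_surjective_of_injective {I Y : Type v} [AddCommGroup Y] [Module A Y]
    {p : (I →₀ M) →ₗ[A] Y} (hp : Function.Surjective p) {i : N →ₗ[A] Y}
    (hi : Function.Injective i) : IsSubgenerated A M N :=
  ⟨I, LinearMap.ker p, (p.quotKerEquivOfSurjective hp).symm.toLinearMap ∘ₗ i,
    (p.quotKerEquivOfSurjective hp).symm.injective.comp hi⟩

variable (A M) in
theorem IsSubgenerated.refl : IsSubgenerated A M M :=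
  isSubgenerated_of_surjective_of_injective
    (Finsupp.uniqueLinearEquiv A M PUnit.unit).surjective
    (i := LinearMap.id) Function.injective_id

theorem IsSubgenerated.of_injective (hN : IsSubgenerated A M N) {f : X →ₗ[A] N}
    (hf : Function.Injective f) : IsSubgenerated A M X :=
  let ⟨I, K, i, hi⟩ := hN
  ⟨I, K, i ∘ₗ f, hi.comp hf⟩

theorem IsSubgenerated.of_surjective (hN : IsSubgenerated A M N) {f : N →ₗ[A] X}
    (hf : Function.Surjective f) : IsSubgenerated A M X := by
  obtain ⟨I, K, i, hi⟩ := hN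
  let L := (LinearMap.ker f).map i
  have mkQ_i_eq_zero (z : N) : L.mkQ (i z) = 0 ↔ f z = 0 := by
    rw [Submodule.mkQ_apply, Submodule.Quotient.mk_eq_zero, Submodule.mem_map]
    exact ⟨fun ⟨y, hy, hyz⟩ => hi hyz ▸ hy, fun hz => ⟨z, hz, rfl⟩⟩
  obtain ⟨j, hj⟩ := exists_comp_eq_of_ker_le_ker hf (g := L.mkQ ∘ₗ i)
    fun z hz => (mkQ_i_eq_zero z).2 hz
  refine isSubgenerated_of_surjective_of_injective
    (L.mkQ_surjective.comp K.mkQ_surjective) (p := L.mkQ ∘ₗ K.mkQ) (i := j) ?_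
  refine (injective_iff_map_eq_zero j).2 fun x hx => ?_
  obtain ⟨z, rfl⟩ := hf x
  exact (mkQ_i_eq_zero z).1 ((LinearMap.congr_fun hj z).symm.trans hx)

theorem IsSubgenerated.submodule (hN : IsSubgenerated A M N) (L : Submodule A N) :
    IsSubgenerated A M L :=
  hN.of_injective L.injective_subtype

theorem IsSubgenerated.quotient (hN : IsSubgenerated A M N) (L : Submodule A N) :
    IsSubgenerated A M (N ⧸ L) :=
  hN.of_surjective L.mkQ_surjective

theorem IsSubgenerated.prod (hN : IsSubgenerated A M N) (hX : IsSubgenerated A M X) :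
    IsSubgenerated A M (N × X) := by
  obtain ⟨I, K, i, hi⟩ := hN
  obtain ⟨J, L, j, hj⟩ := hX
  exact isSubgenerated_of_surjective_of_injective
    (p := K.mkQ.prodMap L.mkQ ∘ₗ (Finsupp.sumFinsuppLEquivProdFinsupp A).toLinearMap)
    ((K.mkQ_surjective.prodMap L.mkQ_surjective).comp (LinearEquiv.surjective _))
    (i := i.prodMap j) (hi.prodMap hj)

end Subgenerated

theorem IsRelInjective.exists_leftInverse {N E : Type v} [AddCommGroup N] [Module A N]
    [AddCommGroup E] [Module A E] (hE : IsRelInjective A N E) {i : E →ₗ[A] N}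
    (hi : Function.Injective i) : ∃ g : N →ₗ[A] E, g ∘ₗ i = LinearMap.id := by
  obtain ⟨g, hg⟩ := hE (LinearMap.range i) (LinearEquiv.ofInjective i hi).symm.toLinearMap
  refine ⟨g, LinearMap.ext fun x => ?_⟩
  have hgx := LinearMap.congr_fun hg (LinearEquiv.ofInjective i hi x)
  rwa [LinearEquiv.coe_coe, LinearEquiv.symm_apply_apply] at hgx

/-- `S` is the monolith of `Q`: the least nonzero submodule. Modules with a monolith are the
subdirectly irreducible (or cocyclic) ones. -/
structure IsMonolith {Q : Type*} [AddCommGroup Q] [Module A Q] (S : Submodule A Q) : Prop where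
  ne_bot : S ≠ ⊥
  le_of_ne_bot : ∀ L : Submodule A Q, L ≠ ⊥ → S ≤ L

namespace IsMonolith

section Basic

variable {Q N X : Type*} [AddCommGroup Q] [Module A Q] [AddCommGroup N] [Module A N]
  [AddCommGroup X] [Module A X] {S : Submodule A Q}

theorem isAtom (hS : IsMonolith S) : IsAtom S :=
  isAtom_iff_le_of_ge.2 ⟨hS.ne_bot, fun L hL _ => hS.le_of_ne_bot L hL⟩

theorem isSimpleModule (hS : IsMonolith S) : IsSimpleModule A S :=
  isSimpleModule_iff_isAtom.2 hS.isAtom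

theorem isSimpleModule_of_eq_top (hS : IsMonolith S) (h : S = ⊤) : IsSimpleModule A Q :=
  (isSimpleModule_iff A Q).2 (isSimpleOrder_iff_isAtom_top.2 (h ▸ hS.isAtom))

theorem exists_mem_ne_zero (hS : IsMonolith S) : ∃ s ∈ S, s ≠ 0 :=
  (Submodule.ne_bot_iff S).1 hS.ne_bot

theorem eq_bot_of_disjoint (hS : IsMonolith S) {L : Submodule A Q} (h : Disjoint L S) : L = ⊥ :=
  by_contra fun hL => hS.ne_bot (disjoint_self.1 (h.mono_left (hS.le_of_ne_bot L hL)))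

theorem injective_or_le_ker (hS : IsMonolith S) (f : Q →ₗ[A] X) :
    Function.Injective f ∨ S ≤ LinearMap.ker f :=
  or_iff_not_imp_left.2 fun hf => hS.le_of_ne_bot _ (mt LinearMap.ker_eq_bot.1 hf)

theorem ker_le_ker (hS : IsMonolith S) {q : N →ₗ[A] Q} {g : N →ₗ[A] X}
    (h : ∀ z, q z ∈ S → g z = 0 → q z = 0) : LinearMap.ker g ≤ LinearMap.ker q := by
  have hmap : (LinearMap.ker g).map q = ⊥ := hS.eq_bot_of_disjoint <| by
    rw [Submodule.disjoint_def]
    rintro _ ⟨z, hz, rfl⟩ hzS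
    exact h z hzS hz
  rwa [← le_bot_iff, Submodule.map_le_iff_le_comap] at hmap

theorem surjective_of_leftInverse (hS : IsMonolith S) {χ g : Q →ₗ[A] Q}
    (hg : g ∘ₗ χ = LinearMap.id) : Function.Surjective χ := by
  have hgχ (y : Q) : g (χ y) = y := LinearMap.congr_fun hg y
  have hginj : Function.Injective g := by
    refine (hS.injective_or_le_ker g).resolve_right fun hker => ?_
    obtain ⟨s, hs, hs0⟩ := hS.exists_mem_ne_zero
    have hχ : LinearMap.range χ ≠ ⊥ := fun h =>
      hs0 (by rw [← hgχ s, LinearMap.range_eq_bot.1 h, LinearMap.zero_apply, map_zero])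
    obtain ⟨t, rfl⟩ := hS.le_of_ne_bot _ hχ hs
    exact hs0 (by rw [← hgχ t, LinearMap.mem_ker.1 (hker hs), map_zero])
  exact fun y => ⟨g y, hginj (hgχ (g y))⟩

theorem length_eq_two (hS : IsMonolith S) (hc : IsCoatom S) : Module.length A Q = 2 := by
  have := hS.isSimpleModule
  have : IsSimpleModule A (Q ⧸ S) := isSimpleModule_iff_isCoatom.2 hc
  rw [Module.length_eq_add_of_exact S.subtype S.mkQ S.injective_subtype S.mkQ_surjective
    (LinearMap.exact_subtype_mkQ S), Module.length_eq_one, Module.length_eq_one, one_add_one_eq_two]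

end Basic

theorem isLocalModule {Q : Type v} [AddCommGroup Q] [Module A Q] {S : Submodule A Q}
    (hS : IsMonolith S) (hc : IsCoatom S) : IsLocalModule A Q := by
  refine ⟨S, hc.1, fun L hL => ?_⟩
  by_cases h : L = ⊥
  · exact h ▸ bot_le
  · exact ((hc.le_iff.1 (hS.le_of_ne_bot L h)).resolve_left hL).le

section Splitting

variable {N Q : Type v} [AddCommGroup N] [Module A N] [AddCommGroup Q] [Module A Q]
  {S : Submodule A Q}

theorem eq_top_of_extends (hS : IsMonolith S) {q : N →ₗ[A] Q} (hq : Function.Surjective q)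
    {g : N →ₗ[A] S} (hg : ∀ z, q z ∈ S → (g z : Q) = q z) : S = ⊤ := by
  have hker : LinearMap.ker g ≤ LinearMap.ker q := hS.ker_le_ker fun z hzS hz => by
    rw [← hg z hzS, hz, Submodule.coe_zero]
  refine (Submodule.eq_top_iff').2 fun y => ?_
  obtain ⟨z, rfl⟩ := hq y
  obtain ⟨w, hw⟩ := hq (g z)
  have hwS : q w ∈ S := hw ▸ (g z).2
  have hgw : g w = g z := Subtype.ext ((hg w hwS).trans hw)
  have hqzw : q (z - w) = 0 := hker (by rw [LinearMap.mem_ker, map_sub, hgw, sub_self])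
  rw [map_sub, sub_eq_zero] at hqzw
  exact hqzw ▸ hwS

theorem ker_eq_ker_of_isIdempotentElem (hS : IsMonolith S) {q : N →ₗ[A] Q} {p : Module.End A N}
    (hp0 : p ≠ 0) (hp : IsIdempotentElem p) (h : S →ₗ[A] LinearMap.range p)
    (hh : ∀ z (hz : q z ∈ S), (h ⟨q z, hz⟩ : N) = p z) : LinearMap.ker q = LinearMap.ker p := by
  have hpp (z : N) : p (p z) = p z := LinearMap.congr_fun hp z
  have hqp : LinearMap.ker q ≤ LinearMap.ker p := fun z hz => by
    have hzS : (⟨q z, hz ▸ S.zero_mem⟩ : S) = 0 := Subtype.ext hz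
    rw [LinearMap.mem_ker, ← hh z (hz ▸ S.zero_mem), hzS, map_zero, Submodule.coe_zero]
  have hh0 : h ≠ 0 := by
    rintro rfl
    have hpS (z : N) (hz : q z ∈ S) : p z = 0 := (hh z hz).symm
    have hrange : LinearMap.ker (1 - p) ≤ LinearMap.ker q := hS.ker_le_ker fun z hzS hz => by
      have hpz : z = p z := sub_eq_zero.1 hz
      rw [hpz, hpS z hzS, map_zero]
    refine hp0 (LinearMap.ext fun z => ?_)
    have hpz : p z ∈ LinearMap.ker (1 - p) := by simp [hpp]
    rw [← hpp]
    exact hqp (hrange hpz)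
  have := hS.isSimpleModule
  refine hqp.antisymm (hS.ker_le_ker fun z hzS hz => ?_)
  have hhz : h ⟨q z, hzS⟩ = 0 := Subtype.ext ((hh z hzS).trans hz)
  exact congrArg Subtype.val
    ((map_eq_zero_iff h (LinearMap.injective_of_ne_zero hh0)).1 hhz)

theorem exists_section (hS : IsMonolith S) (hne : S ≠ ⊤) (hSN : IsAlmostRelInjective A N S)
    {q : N →ₗ[A] Q} (hq : Function.Surjective q) :
    ∃ χ : Q →ₗ[A] N, q ∘ₗ χ = LinearMap.id := by
  rcases hSN (S.comap q) (q.restrict fun _ hz => hz) with ⟨g, hg⟩ | ⟨p, hp0, hp, h, hh⟩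
  · refine absurd (hS.eq_top_of_extends hq (g := g) fun z hz => ?_) hne
    exact congrArg Subtype.val (LinearMap.congr_fun hg ⟨z, hz⟩)
  · have hker := hS.ker_eq_ker_of_isIdempotentElem hp0 hp h fun z hz => hh ⟨z, hz⟩
    obtain ⟨χ, hχ⟩ := exists_comp_eq_of_ker_le_ker hq hker.le
    refine ⟨χ, LinearMap.ext fun y => ?_⟩
    obtain ⟨z, rfl⟩ := hq y
    have hz : p z - z ∈ LinearMap.ker q := by
      rw [hker, LinearMap.mem_ker, map_sub, sub_eq_zero]
      exact LinearMap.congr_fun hp z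
    rw [LinearMap.mem_ker, map_sub, sub_eq_zero] at hz
    exact (congrArg q (LinearMap.congr_fun hχ z)).trans hz

end Splitting

end IsMonolith

theorem exists_isMonolith_quotient {N : Type*} [AddCommGroup N] [Module A N] {Z : Submodule A N}
    {x : N} (hx : x ∉ Z) :
    ∃ C : Submodule A N, Z ≤ C ∧ x ∉ C ∧ IsMonolith (Submodule.span A {C.mkQ x}) := by
  obtain ⟨C, hZC, hC⟩ := zorn_le_nonempty₀ {L : Submodule A N | x ∉ L} (by
    intro c hc hchain y hy
    refine ⟨sSup c, fun hxc => ?_, fun L hL => le_sSup hL⟩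
    obtain ⟨L, hL, hxL⟩ := (Submodule.mem_sSup_of_directed ⟨y, hy⟩ hchain.directedOn).1 hxc
    exact hc hL hxL) Z hx
  refine ⟨C, hZC, hC.prop, ?_, fun L hL => ?_⟩
  · rw [Ne, Submodule.span_singleton_eq_bot, Submodule.mkQ_apply, Submodule.Quotient.mk_eq_zero]
    exact hC.prop
  · rw [Submodule.span_singleton_le_iff_mem]
    by_contra hxL
    have hLC : L.comap C.mkQ ≤ C := hC.le_of_ge hxL (Submodule.le_comap_mkQ C L)
    exact hL (by rw [← Submodule.map_comap_eq_of_surjective C.mkQ_surjective L, eq_bot_iff,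
      Submodule.map_le_iff_le_comap, ← LinearMap.ker, Submodule.ker_mkQ]; exact hLC)

section AlmostVModule

variable {M N Q : Type v} [AddCommGroup M] [Module A M] [AddCommGroup N] [Module A N]
  [AddCommGroup Q] [Module A Q] {S : Submodule A Q}

theorem IsAlmostVModule.exists_section (hM : IsAlmostVModule A M) (hN : IsSubgenerated A M N)
    (hS : IsMonolith S) (hne : S ≠ ⊤) {q : N →ₗ[A] Q} (hq : Function.Surjective q) :
    ∃ χ : Q →ₗ[A] N, q ∘ₗ χ = LinearMap.id :=
  hS.exists_section hne (hM S hS.isSimpleModule N hN) hq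

theorem IsAlmostVModule.isRelProjective (hM : IsAlmostVModule A M) (hQ : IsSubgenerated A M Q)
    (hN : IsSubgenerated A M N) (hS : IsMonolith S) (hne : S ≠ ⊤) : IsRelProjective A N Q := by
  intro K f
  let P : Submodule A (Q × N) :=
    LinearMap.eqLocus (f ∘ₗ LinearMap.fst A Q N) (K.mkQ ∘ₗ LinearMap.snd A Q N)
  let q : P →ₗ[A] Q := LinearMap.fst A Q N ∘ₗ P.subtype
  have hq : Function.Surjective q := fun y =>
    let ⟨n, hn⟩ := K.mkQ_surjective (f y)
    ⟨⟨(y, n), hn.symm⟩, rfl⟩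
  obtain ⟨χ, hχ⟩ := hM.exists_section ((hQ.prod hN).submodule P) hS hne hq
  refine ⟨LinearMap.snd A Q N ∘ₗ P.subtype ∘ₗ χ, LinearMap.ext fun y => ?_⟩
  have hy : f (χ y).1.1 = K.mkQ (χ y).1.2 := (χ y).2
  exact hy.symm.trans (congrArg f (LinearMap.congr_fun hχ y))

theorem IsAlmostVModule.exists_isCoatom_or_section (hM : IsAlmostVModule A M)
    (hN : IsSubgenerated A M N) {Z : Submodule A N} {x : N} (hx : x ∉ Z) :
    ∃ C : Submodule A N, Z ≤ C ∧ x ∉ C ∧ IsMonolith (Submodule.span A {C.mkQ x}) ∧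
      (IsCoatom C ∨ ∃ χ : (N ⧸ C) →ₗ[A] N, C.mkQ ∘ₗ χ = LinearMap.id) := by
  obtain ⟨C, hZC, hxC, hS⟩ := exists_isMonolith_quotient hx
  refine ⟨C, hZC, hxC, hS, ?_⟩
  by_cases htop : Submodule.span A {C.mkQ x} = ⊤
  · exact Or.inl (isSimpleModule_iff_isCoatom.1 (hS.isSimpleModule_of_eq_top htop))
  · exact Or.inr (hM.exists_section hN hS htop C.mkQ_surjective)

theorem IsAlmostVModule.isSemisimpleModule_jacobson (hM : IsAlmostVModule A M)
    (hN : IsSubgenerated A M N) : IsSemisimpleModule A (Module.jacobson A N) := by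
  let soc : Submodule A N := ⨆ L ∈ {L : Submodule A N | IsSimpleModule A L}, L
  have hsoc : IsSemisimpleModule A soc :=
    isSemisimpleModule_biSup_of_isSemisimpleModule_submodule
      fun L (hL : IsSimpleModule A L) => inferInstance
  have simple_le_soc (L : Submodule A N) (hL : IsSimpleModule A L) : L ≤ soc :=
    le_biSup (fun L : Submodule A N => L) hL
  have hle : Module.jacobson A N ≤ soc := by
    intro x hx
    by_contra hxs
    obtain ⟨C, hsC, hxC, hS, hC | ⟨χ, hχ⟩⟩ := hM.exists_isCoatom_or_section hN hxs
    · exact hxC (Submodule.mem_sInf.1 hx C hC)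
    · have hχx : C.mkQ (χ (C.mkQ x)) = C.mkQ x := LinearMap.congr_fun hχ _
      have hχinj : Function.Injective χ := Function.LeftInverse.injective (LinearMap.congr_fun hχ)
      have := hS.isSimpleModule
      have hT : IsSimpleModule A ((Submodule.span A {C.mkQ x}).map χ) :=
        IsSimpleModule.congr (Submodule.equivMapOfInjective χ hχinj _).symm
      have hTC : (Submodule.span A {C.mkQ x}).map χ ≤ C := (simple_le_soc _ hT).trans hsC
      have hmem : χ (C.mkQ x) ∈ C :=
        hTC (Submodule.mem_map_of_mem (Submodule.mem_span_singleton_self _))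
      have hx0 : C.mkQ x = 0 := hχx.symm.trans ((Submodule.Quotient.mk_eq_zero C).2 hmem)
      exact hxC ((Submodule.Quotient.mk_eq_zero C).1 hx0)
  exact IsSemisimpleModule.of_injective _ (Submodule.inclusion_injective hle)

theorem IsAlmostVModule.exists_isCoatom_notMem_of_jacobson_eq_bot (hM : IsAlmostVModule A M)
    (hN : IsSubgenerated A M N) (hJ : Module.jacobson A N = ⊥) {Z : Submodule A N} {x : N}
    (hx : x ∉ Z) : ∃ C : Submodule A N, IsCoatom C ∧ Z ≤ C ∧ x ∉ C := by
  obtain ⟨C, hZC, hxC, hS, hC | ⟨χ, hχ⟩⟩ := hM.exists_isCoatom_or_section hN hx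
  · exact ⟨C, hC, hZC, hxC⟩
  have hχx : C.mkQ (χ (C.mkQ x)) = C.mkQ x := LinearMap.congr_fun hχ _
  have hχJ : χ (C.mkQ x) ∉ Module.jacobson A N := by
    rw [hJ, Submodule.mem_bot]
    intro h0
    rw [h0, map_zero, eq_comm, ← LinearMap.mem_ker, C.ker_mkQ] at hχx
    exact hxC hχx
  obtain ⟨W, hW, hχW⟩ : ∃ W : Submodule A N, IsCoatom W ∧ χ (C.mkQ x) ∉ W := by
    simpa [Module.jacobson, Submodule.mem_sInf] using hχJ
  have : IsSimpleModule A (N ⧸ W) := isSimpleModule_iff_isCoatom.2 hW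
  let ψ : (N ⧸ C) →ₗ[A] (N ⧸ W) := W.mkQ ∘ₗ χ
  have hψx : ψ (C.mkQ x) ≠ 0 := mt (Submodule.Quotient.mk_eq_zero W).1 hχW
  have hψinj : Function.Injective ψ := (hS.injective_or_le_ker ψ).resolve_right fun hker =>
    hψx (hker (Submodule.mem_span_singleton_self _))
  have hψsurj : Function.Surjective ψ := LinearMap.surjective_of_ne_zero fun h =>
    hψx (LinearMap.congr_fun h _)
  have : IsSimpleModule A (N ⧸ C) := .congr (LinearEquiv.ofBijective ψ ⟨hψinj, hψsurj⟩)
  exact ⟨C, isSimpleModule_iff_isCoatom.1 this, hZC, hxC⟩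

theorem isVModule_of_forall_exists_isCoatom_notMem
    (h : ∀ (Z : Submodule A N) (x : N), x ∉ Z → ∃ C : Submodule A N, IsCoatom C ∧ Z ≤ C ∧ x ∉ C) :
    IsVModule A N := by
  intro T _ _ hT L f
  by_cases hf : f = 0
  · exact ⟨0, by rw [hf, LinearMap.zero_comp]⟩
  obtain ⟨x, hx⟩ : ∃ x, f x ≠ 0 := DFunLike.exists_ne hf
  have hxZ : (x : N) ∉ (LinearMap.ker f).map L.subtype := by
    rintro ⟨y, hy, hyx⟩
    exact hx (Subtype.ext hyx ▸ hy)
  obtain ⟨C, hC, hfC, hxC⟩ := h _ _ hxZ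
  have : IsSimpleModule A (N ⧸ C) := isSimpleModule_iff_isCoatom.2 hC
  let φ : L →ₗ[A] N ⧸ C := C.mkQ ∘ₗ L.subtype
  have hφ : φ ≠ 0 := fun h0 =>
    hxC ((Submodule.Quotient.mk_eq_zero C).1 (LinearMap.congr_fun h0 x))
  have hle : LinearMap.ker f ≤ LinearMap.ker φ := by
    rwa [LinearMap.ker_comp, C.ker_mkQ, ← Submodule.map_le_iff_le_comap]
  have hker : LinearMap.ker φ = LinearMap.ker f :=
    ((LinearMap.isCoatom_ker_of_surjective (LinearMap.surjective_of_ne_zero hf)).le_iff.1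
      hle).resolve_left (mt LinearMap.ker_eq_top.1 hφ)
  obtain ⟨g, hg⟩ := exists_comp_eq_of_ker_le_ker (LinearMap.surjective_of_ne_zero hφ) hker.le
  exact ⟨g ∘ₗ C.mkQ, hg⟩

theorem IsAlmostVModule.isVModule_of_jacobson_eq_bot (hM : IsAlmostVModule A M)
    (hN : IsSubgenerated A M N) (hJ : Module.jacobson A N = ⊥) : IsVModule A N :=
  isVModule_of_forall_exists_isCoatom_notMem fun _ _ hx =>
    hM.exists_isCoatom_notMem_of_jacobson_eq_bot hN hJ hx

theorem IsAlmostVModule.eq_top_or_eq_top_of_sup_eq_top (hM : IsAlmostVModule A M)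
    (hQ : IsSubgenerated A M Q) (hinj : IsRelInjective A Q Q) (hS : IsMonolith S) (hne : S ≠ ⊤)
    {L₁ L₂ : Submodule A Q} (hL : L₁ ⊔ L₂ = ⊤) : L₁ = ⊤ ∨ L₂ = ⊤ := by
  let q : L₁ × L₂ →ₗ[A] Q := L₁.subtype.coprod L₂.subtype
  have hq : Function.Surjective q := by
    rw [← LinearMap.range_eq_top, LinearMap.range_coprod, L₁.range_subtype, L₂.range_subtype, hL]
  obtain ⟨χ, hχ⟩ := hM.exists_section ((hQ.submodule L₁).prod (hQ.submodule L₂)) hS hne hq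
  have eq_top {L : Submodule A Q} (π : Q →ₗ[A] L) (hπ : Function.Injective π) : L = ⊤ := by
    obtain ⟨g, hg⟩ := hinj.exists_leftInverse (L.injective_subtype.comp hπ) (i := L.subtype ∘ₗ π)
    refine (Submodule.eq_top_iff').2 fun y => ?_
    obtain ⟨z, rfl⟩ := hS.surjective_of_leftInverse hg y
    exact (π z).2
  rcases hS.injective_or_le_ker (LinearMap.fst A L₁ L₂ ∘ₗ χ) with h₁ | h₁
  · exact Or.inl (eq_top _ h₁)
  rcases hS.injective_or_le_ker (LinearMap.snd A L₁ L₂ ∘ₗ χ) with h₂ | h₂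
  · exact Or.inr (eq_top _ h₂)
  obtain ⟨s, hs, hs0⟩ := hS.exists_mem_ne_zero
  have hχs : χ s = 0 := Prod.ext (h₁ hs) (h₂ hs)
  exact absurd (LinearMap.congr_fun hχ s).symm (by simpa [hχs] using hs0)

theorem IsAlmostVModule.exists_isCoatom_notMem_of_isMonolith (hM : IsAlmostVModule A M)
    (hQ : IsSubgenerated A M Q) (hS : IsMonolith S) {x : Q} (hx : x ∉ S) :
    ∃ C : Submodule A Q, IsCoatom C ∧ S ≤ C ∧ x ∉ C := by
  obtain ⟨C, hSC, hxC, -, hC | ⟨χ, hχ⟩⟩ := hM.exists_isCoatom_or_section hQ hx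
  · exact ⟨C, hC, hSC, hxC⟩
  have hχy (y : Q ⧸ C) : C.mkQ (χ y) = y := LinearMap.congr_fun hχ y
  have hrange : LinearMap.range χ = ⊥ := hS.eq_bot_of_disjoint <| by
    rw [Submodule.disjoint_def]
    rintro _ ⟨y, rfl⟩ hyS
    have hy : C.mkQ (χ y) = 0 := (Submodule.Quotient.mk_eq_zero C).2 (hSC hyS)
    rw [← hχy y, hy, map_zero]
  have hx0 : C.mkQ x = 0 := by
    rw [← hχy (C.mkQ x), LinearMap.range_eq_bot.1 hrange, LinearMap.zero_apply, map_zero]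
  exact absurd ((Submodule.Quotient.mk_eq_zero C).1 hx0) hxC

theorem IsAlmostVModule.eq_top_or_isCoatom (hM : IsAlmostVModule A M)
    (hQ : IsSubgenerated A M Q) (hinj : IsRelInjective A Q Q) (hS : IsMonolith S) :
    S = ⊤ ∨ IsCoatom S := by
  refine or_iff_not_imp_left.2 fun hne => ?_
  obtain ⟨x, -, hx⟩ := SetLike.exists_of_lt (lt_top_iff_ne_top.2 hne)
  obtain ⟨C, hC, hSC, -⟩ := hM.exists_isCoatom_notMem_of_isMonolith hQ hS hx
  suffices C ≤ S from hSC.antisymm this ▸ hC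
  intro y hyC
  by_contra hyS
  obtain ⟨D, hD, -, hyD⟩ := hM.exists_isCoatom_notMem_of_isMonolith hQ hS hyS
  have hCD : C ⊔ D = ⊤ := hC.sup_eq_top_of_ne hD fun h => hyD (h ▸ hyC)
  exact (hM.eq_top_or_eq_top_of_sup_eq_top hQ hinj hS hne hCD).elim hC.1 hD.1

theorem IsInjectiveHullIn.isMonolith_range {T : Type v} [AddCommGroup T] [Module A T]
    [IsSimpleModule A T] {i : T →ₗ[A] Q} (hi : IsInjectiveHullIn A M i) :
    IsMonolith (LinearMap.range i) := by
  have hatom : IsAtom (LinearMap.range i) := isSimpleModule_iff_isAtom.1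
    (.congr (LinearEquiv.ofInjective i hi.mono).symm)
  refine ⟨hatom.1, fun L hL => ?_⟩
  exact (hatom.not_disjoint_iff_le).1 fun h => hL (hi.essential L h.symm.eq_bot)

end AlmostVModule

end AlmostV

/-- Right `R`-modules are modules over `Rᵐᵒᵖ`. -/
theorem proposition2p1 {R : Type u} [Ring R] (M : Type v) [AddCommGroup M] [Module Rᵐᵒᵖ M]
    (hM : AlmostV.IsAlmostVModule Rᵐᵒᵖ M) :
    (∀ (N : Type v) [AddCommGroup N] [Module Rᵐᵒᵖ N], AlmostV.IsSubgenerated Rᵐᵒᵖ M N →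
      IsSemisimpleModule Rᵐᵒᵖ (Module.jacobson Rᵐᵒᵖ N)) ∧
    (∀ (N : Type v) [AddCommGroup N] [Module Rᵐᵒᵖ N], AlmostV.IsSubgenerated Rᵐᵒᵖ M N →
      AlmostV.IsVModule Rᵐᵒᵖ (N ⧸ Module.jacobson Rᵐᵒᵖ N)) ∧
    (∀ (S : Type v) [AddCommGroup S] [Module Rᵐᵒᵖ S], AlmostV.IsSubgenerated Rᵐᵒᵖ M S →
      IsSimpleModule Rᵐᵒᵖ S →
      ∀ (E : Type v) [AddCommGroup E] [Module Rᵐᵒᵖ E] (i : S →ₗ[Rᵐᵒᵖ] E),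
        AlmostV.IsInjectiveHullIn Rᵐᵒᵖ M i →
        IsSimpleModule Rᵐᵒᵖ E ∨
          (AlmostV.IsLocalModule Rᵐᵒᵖ E ∧ AlmostV.IsRelProjective Rᵐᵒᵖ M E ∧
            Module.length Rᵐᵒᵖ E = 2)) := by
  refine ⟨fun N _ _ hN => hM.isSemisimpleModule_jacobson hN, fun N _ _ hN => ?_,
    fun S _ _ _ _ E _ _ i hi => ?_⟩
  · exact hM.isVModule_of_jacobson_eq_bot (hN.quotient _) (Module.jacobson_quotient_jacobson _ _)
  · have hS := hi.isMonolith_range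
    refine (hM.eq_top_or_isCoatom hi.mem (hi.injective_object E hi.mem) hS).imp
      hS.isSimpleModule_of_eq_top fun hc => ?_
    exact ⟨hS.isLocalModule hc, hM.isRelProjective hi.mem (.refl _ M) hS hc.1, hS.length_eq_two hc⟩
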